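/- Let $F$ be a field of characteristic $p>0$ equipped with a real valuation $v\colon F\to\mathbb{R}\cup\{\infty\}$ (that is, $v(a)=\infty$ if and only if $a=0$, $v(ab)=v(a)+v(b)$ and $v(a+b)\ge\min\{v(a),v(b)\}$), and suppose that $(F,v)$ is henselian (Hensel's lemma holds in the valuation ring of $v$). Let $E$ be a field extension of $F$ (separable or not) of degree $p$, equipped with the extension of $v$ to a real valuation on $E$, again denoted $v$. Let $x\in E$ generate $E$ over $F$. Then $T=\{1,x,\dots,x^{p-1}\}$ is a basis of $E$ over $F$, and $$d(T)=(p-1)\,\mathrm{ndist}(x,F)$$ in $\mathbb{R}\cup\{\infty\}$. Here $$d(T)=\sup\Bigl\{\,v(u)-\min_{0\le i\le p-1} v(c_i x^i)\;:\; u=\sum_{i=0}^{p-1}c_i x^i\neq 0,\ c_i\in F\Bigr\}$$ is the discrepancy of the basis $T$, and $$\mathrm{ndist}(x,F)=\sup\{\,v(x-y)-v(x)\;:\;y\in F\,\}$$ is the normalized distance from $x$ to $F$; both suprema may be infinite. -/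

import Mathlib

/-- A real Krull valuation on a field `F`, written additively: `v 0 = ∞`, `v 1 = 0`,
`v (x * y) = v x + v y` and `min (v x) (v y) ≤ v (x + y)`. As `F` is a field, `v x = ∞` only
for `x = 0`. The trivial valuation is allowed. -/
abbrev RealValuation (F : Type*) [Field F] : Type _ := AddValuation F (WithTop ℝ)

namespace RealValuation

/-- The valued field `(F, v)` is henselian: Hensel's lemma (lifting of simple roots of monic
polynomials) holds in its valuation ring `{a | 0 ≤ v a}`. -/
def IsHenselian {F : Type*} [Field F] (v : RealValuation F) : Prop :=
  HenselianLocalRing (AddValuation.toValuation v).integer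

/-- The inclusion of `ℝ ∪ {∞}` into the extended real line. -/
def toEReal (a : WithTop ℝ) : EReal := WithBot.some a

/-- The normalized distance `sup {v (x - y) - v x | y ∈ S}` from `x` to `S`, in the extended
real line. -/
noncomputable def ndist {G : Type*} [AddCommGroup G] (v : G → WithTop ℝ) (x : G) (S : Set G) :
    EReal :=
  ⨆ y ∈ S, (toEReal (v (x - y)) - toEReal (v x))

/-- The discrepancy `f u - min_i f (c_i e_i)` of a basis `e` with respect to the vector
`u = ∑ i, c_i e_i`. -/
noncomputable def discrepancyAt {F V ι : Type*} [Field F] [AddCommGroup V] [Module F V] [Fintype ι]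
    (f : V → WithTop ℝ) (e : Module.Basis ι F V) (u : V) : EReal :=
  toEReal (f u) - toEReal (Finset.univ.inf fun i => f (e.repr u i • e i))

/-- The discrepancy of a basis: the supremum, in the extended real line, of its discrepancies with
respect to the nonzero vectors. -/
noncomputable def discrepancy {F V ι : Type*} [Field F] [AddCommGroup V] [Module F V] [Fintype ι]
    (f : V → WithTop ℝ) (e : Module.Basis ι F V) : EReal :=
  ⨆ (u : V) (_ : u ≠ 0), discrepancyAt f e u

end RealValuation

/-! Write `u = g(x)` with `deg g < p` and factor `g` over an algebraic closure. A root `a` has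
degree `n < p` over `F`, prime to `[E : F]`, so its conjugates over `F` are conjugate over `E`. As
the henselian valuation extends uniquely, `v(x - b)` is the same for every conjugate `b` of `a`.
Since `v(n) = 0`, the mean `y ∈ F` of the conjugates satisfies `v(x - y) ≥ v(x - a)`. Hence `v(x -
a) - min(v(x), v(a)) ≤ v(x - y) - v(x)`, with `y = 0` sufficing when `v(a) < v(x)`
(`exists_mul_spectralNorm_sub_le`). The Gauss norm of radius `|x|` is multiplicative, so these
bounds add up over the at most `p - 1` roots (`gaussNorm_mul_pow_le`,
`exists_gaussNorm_mul_pow_le`). Conversely, `u = (x - y)^(p-1)` shows that the bound is sharp.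

Uniqueness comes from Hensel's lemma: the integral closure of the valuation ring is a valuation ring
(`HenselianLocalRing.isIntegral_or_isIntegral_inv`), so the spectral norm is multiplicative and is
the only extension (`AbsoluteValue.eq_spectralNorm`). -/

open Polynomial IsLocalRing

/-! ### Hensel's lemma and locality of Galois integral closures -/

open scoped Pointwise in
-- Maximal ideals of `B` are conjugate. If there were two, some `z ∉ M`, fixed by the stabilizer of
-- `M`, would have all its other conjugates in `M`. Its orbit polynomial then has a simple nonzero
-- root modulo `M`; Hensel's lemma forces `z` into the image of `R`, so `z` cannot have a conjugate
-- in `M`.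
theorem HenselianLocalRing.isLocalRing_of_isInvariant (R B G : Type*) [CommRing R]
    [HenselianLocalRing R] [CommRing B] [IsDomain B] [Algebra R B] [Group G] [Finite G]
    [MulSemiringAction G B] [SMulCommClass G R B] [Algebra.IsInvariant R B G] : IsLocalRing B := by
  classical
  have := Fintype.ofFinite G
  have hint : Algebra.IsIntegral R B := Algebra.IsInvariant.isIntegral R B G
  have hunder (M : Ideal B) (hM : M.IsMaximal) : M.under R = maximalIdeal R :=
    IsLocalRing.eq_maximalIdeal (Ideal.isMaximal_comap_of_isIntegral_of_isMaximal M)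
  obtain ⟨M, hM⟩ := Ideal.exists_maximal B
  refine IsLocalRing.of_unique_max_ideal ⟨M, hM, fun M' hM' ↦ ?_⟩
  by_contra hne
  obtain ⟨g₀, hg₀⟩ := Algebra.IsInvariant.exists_smul_of_under_eq R B G M M'
    ((hunder M hM).trans (hunder M' hM').symm)
  have hmax (g : G) : (g • M).IsMaximal := by
    have := hM
    exact Ideal.map_isMaximal_of_equiv (MulSemiringAction.toRingEquiv G B g)
  -- an element in all conjugates of `M` other than `M`
  let T : Finset (Ideal B) := (Finset.univ.image fun g : G ↦ g • M).erase M
  have hyT : ∃ y : B, (∀ J ∈ T, y ∈ J) ∧ y ∉ M := by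
    by_contra! hcon
    have hle : T.inf id ≤ M := fun y hy ↦ hcon y fun J hJ ↦ (Finset.inf_le hJ : T.inf id ≤ J) hy
    obtain ⟨J, hJ, hJM⟩ := (Ideal.IsPrime.inf_le' hM.isPrime).1 hle
    obtain ⟨hJne, g, rfl⟩ : J ≠ M ∧ ∃ g : G, g • M = J := by simpa [T] using hJ
    exact hJne ((hmax g).eq_of_le hM.ne_top hJM)
  obtain ⟨y, hyT, hyM⟩ := hyT
  let D := MulAction.stabilizer G M
  let z : B := ∏ d : D, (d : G) • y
  have hzD (g : G) (hg : g • M = M) : g • z = z := by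
    simp only [z, Finset.smul_prod', smul_smul]
    exact Fintype.prod_equiv (Equiv.mulLeft (⟨g, hg⟩ : D)) _ _ fun d ↦ rfl
  have hzM : z ∉ M := by
    intro h
    obtain ⟨d, -, hd⟩ := (hM.isPrime.prod_mem_iff).1 h
    have hd' : (d : G) • M = M := d.2
    rw [← hd', Ideal.smul_mem_pointwise_smul_iff] at hd
    exact hyM hd
  have hzT (J) (hJ : J ∈ T) : z ∈ J := by
    refine J.mem_of_dvd (Finset.dvd_prod_of_mem _ (Finset.mem_univ (1 : D))) ?_
    simpa using hyT J hJ
  have hconj (g : G) (hg : g • z ∉ M) : g • z = z := by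
    refine hzD g ?_
    by_contra hne
    refine hg ?_
    have h1 : g⁻¹ • M ∈ T := by
      simp only [T, Finset.mem_erase, Finset.mem_image, Finset.mem_univ, true_and,
        exists_apply_eq_apply, and_true]
      rwa [ne_eq, inv_smul_eq_iff, eq_comm]
    simpa [Ideal.mem_inv_pointwise_smul_iff] using hzT _ h1
  -- the product over the orbit of `z`
  let S : Finset B := Finset.univ.image fun g : G ↦ g • z
  have hzS : z ∈ S := Finset.mem_image.2 ⟨1, Finset.mem_univ _, one_smul _ _⟩
  let Q : B[X] := ∏ s ∈ S, (X - C s)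
  have hQmonic : Q.Monic := monic_prod_of_monic _ _ fun s _ ↦ monic_X_sub_C s
  have hQinv (g : G) : g • Q = Q := by
    simp only [Q, Finset.smul_prod', smul_sub, smul_X, smul_C]
    refine Finset.prod_bij (fun s _ ↦ g • s) ?_ ?_ ?_ ?_
    · intro s hs
      obtain ⟨h, -, rfl⟩ := Finset.mem_image.1 hs
      exact Finset.mem_image.2 ⟨g * h, Finset.mem_univ _, mul_smul _ _ _⟩
    · intro s _ t _ hst
      exact smul_left_cancel g hst
    · intro s hs
      obtain ⟨h, -, rfl⟩ := Finset.mem_image.1 hs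
      exact ⟨(g⁻¹ * h) • z, Finset.mem_image.2 ⟨_, Finset.mem_univ _, rfl⟩, by simp [smul_smul]⟩
    · intros; rfl
  have hQlift : Q ∈ Polynomial.lifts (algebraMap R B) :=
    (Q.lifts_iff_coeff_lifts).2 fun n ↦ Algebra.IsInvariant.isInvariant (A := R) (G := G) _
      fun g ↦ by rw [← coeff_smul, hQinv]
  obtain ⟨q, hqQ, -, hqmonic⟩ := lifts_and_natDegree_eq_and_monic hQlift hQmonic
  have hg₀z : g₀⁻¹ • z ∈ M := by
    rw [← Ideal.mem_inv_pointwise_smul_iff, inv_inv, ← hg₀]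
    refine hzT M' ?_
    simp only [T, Finset.mem_erase, Finset.mem_image, Finset.mem_univ, true_and]
    exact ⟨hne, g₀, hg₀.symm⟩
  -- the reduction of the orbit product modulo `M`
  let π : R →+* B ⧸ M := (Ideal.Quotient.mk M).comp (algebraMap R B)
  have hπ (r : R) : π r = 0 ↔ r ∈ maximalIdeal R := by
    rw [← hunder M hM, Ideal.under_def, Ideal.mem_comap, ← Ideal.Quotient.eq_zero_iff_mem]
    rfl
  set w : B ⧸ M := Ideal.Quotient.mk M z with hw
  have hw0 : w ≠ 0 := fun h ↦ hzM (Ideal.Quotient.eq_zero_iff_mem.1 h)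
  obtain ⟨k, hk0, hqπ⟩ : ∃ k : ℕ, k ≠ 0 ∧ q.map π = (X - C w) * X ^ k := by
    refine ⟨(S.erase z).card, ?_, ?_⟩
    · refine Finset.card_ne_zero_of_mem (a := g₀⁻¹ • z) (Finset.mem_erase.2 ⟨?_, ?_⟩)
      · intro h
        exact hzM (h ▸ hg₀z)
      · exact Finset.mem_image.2 ⟨_, Finset.mem_univ _, rfl⟩
    · rw [← Polynomial.map_map, hqQ, Polynomial.map_prod, ← Finset.mul_prod_erase _ _ hzS,
        Finset.prod_eq_pow_card (b := X)]
      · simp [hw]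
      · intro s hs
        obtain ⟨hsz, hs⟩ := Finset.mem_erase.1 hs
        obtain ⟨g, -, rfl⟩ := Finset.mem_image.1 hs
        have : g • z ∈ M := by
          by_contra h
          exact hsz (hconj g h)
        simp [Ideal.Quotient.eq_zero_iff_mem.2 this]
  have hprime := hM.isPrime
  -- The coefficient of `X ^ k` in `(X - C w) * X ^ k` is `-w`, so the simple root `w` already comes
  -- from `R`.
  have ha₀ : π (-q.coeff k) = w := by
    have := congrArg (fun f ↦ coeff f k) hqπ
    obtain ⟨l, rfl⟩ := Nat.exists_eq_succ_of_ne_zero hk0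
    simp only [coeff_map, sub_mul, coeff_sub, coeff_C_mul, coeff_X_pow, coeff_X_mul] at this
    simp [this]
  obtain ⟨r, hr, hra⟩ := HenselianLocalRing.is_henselian q hqmonic (-q.coeff k)
    (by rw [← hπ, ← eval_map_apply, hqπ, ha₀]; simp)
    (by
      rw [← notMem_maximalIdeal, ← hπ, ← eval_map_apply, ← derivative_map, hqπ, ha₀]
      simp [derivative_mul, hw0])
  have hrw : π r = w := by
    rw [← hπ, map_sub, ha₀, sub_eq_zero] at hra
    exact hra
  have hroot : Q.eval (algebraMap R B r) = 0 := by
    rw [← hqQ, eval_map_apply, hr.eq_zero, map_zero]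
  simp only [Q, eval_prod, eval_sub, eval_X, eval_C, Finset.prod_eq_zero_iff, sub_eq_zero] at hroot
  obtain ⟨s, hs, hrs⟩ := hroot
  obtain ⟨g, -, rfl⟩ := Finset.mem_image.1 hs
  have hgz : g • z = z := hconj g fun h ↦ by
    rw [← hrs, ← Ideal.Quotient.eq_zero_iff_mem] at h
    exact hw0 (hrw.symm.trans h)
  rw [← hgz, ← hrs, smul_algebraMap, hrs, hgz] at hg₀z
  exact hzM hg₀z

/-! ### Polynomials with a unit coefficient -/

/-- With `c` the leading coefficient, `b = c z` is integral, hence in `B`. If `c` or `b` is a unit,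
the claim is immediate. Otherwise replacing `c z ^ (d + 1)` by `b z ^ d` lowers the degree, and a
unit coefficient survives because `B` is local. -/
theorem mem_range_or_inv_mem_range_of_aeval_eq_zero {B N : Type*} [CommRing B] [IsLocalRing B]
    [Field N] [Algebra B N] [IsIntegrallyClosedIn B N] (P : B[X]) {z : N} (hz : aeval z P = 0)
    (hP : ∃ i, IsUnit (P.coeff i)) :
    z ∈ (algebraMap B N).range ∨ z⁻¹ ∈ (algebraMap B N).range := by
  obtain ⟨d, hd⟩ : ∃ d, P.natDegree ≤ d := ⟨_, le_rfl⟩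
  induction d generalizing P with
  | zero =>
    obtain ⟨c, rfl⟩ := natDegree_eq_zero.1 (Nat.le_zero.1 hd)
    obtain ⟨i, hi⟩ := hP
    rw [aeval_C] at hz
    rw [coeff_C] at hi
    split_ifs at hi with h0
    · exact absurd hz (hi.map (algebraMap B N)).ne_zero
    · exact absurd hi not_isUnit_zero
  | succ d ih =>
    obtain hd' | h := Nat.le_succ_iff.1 hd
    · exact ih P hz hP hd'
    have hlc : P.leadingCoeff = P.coeff (d + 1) := by rw [leadingCoeff, h]
    set c := P.coeff (d + 1) with hc
    obtain ⟨b, hb⟩ := IsIntegrallyClosedIn.isIntegral_iff.1 (isIntegral_leadingCoeff_smul P z hz)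
    rw [hlc, Algebra.smul_def] at hb
    by_cases hcu : IsUnit c
    · left
      obtain ⟨u, hu⟩ := hcu
      refine ⟨↑u⁻¹ * b, ?_⟩
      rw [map_mul, hb, ← hu, ← mul_assoc, ← map_mul, Units.inv_mul, map_one, one_mul]
    by_cases hbu : IsUnit b
    · right
      obtain ⟨u, hu⟩ := hbu
      refine ⟨↑u⁻¹ * c, ?_⟩
      refine eq_inv_of_mul_eq_one_left ?_
      rw [map_mul, mul_assoc, ← hb, ← map_mul, ← hu, Units.inv_mul, map_one]
    let Q : B[X] := P.eraseLead + C b * X ^ d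
    have hco (i : ℕ) : Q.coeff i = if i = d + 1 then 0 else P.coeff i + if i = d then b else 0 := by
      simp only [Q, coeff_add, eraseLead_coeff, h, coeff_C_mul_X_pow]
      split_ifs <;> simp_all
    refine ih Q ?_ ?_ ?_
    · rw [← hz, ← P.eraseLead_add_C_mul_X_pow, hlc, h]
      simp only [Q, map_add, map_mul, aeval_C, map_pow, aeval_X, hb, pow_succ]
      ring
    · obtain ⟨i, hi⟩ := hP
      have hid : i ≠ d + 1 := by
        rintro rfl
        exact hcu hi
      refine ⟨i, ?_⟩
      rw [hco, if_neg hid]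
      by_contra hcon
      refine hcon ?_
      split_ifs at hcon ⊢
      · by_contra hn
        exact (IsLocalRing.nonunits_add hn (b := -b) (by simpa using hbu)) (by simpa using hi)
      · simpa using hi
    · refine natDegree_le_iff_coeff_eq_zero.2 fun i hi ↦ ?_
      rw [hco]
      split_ifs with h1 h2
      · rfl
      · omega
      · rw [add_zero]
        exact coeff_eq_zero_of_natDegree_lt (by omega)

theorem ValuationRing.exists_dvd_of_finset {R ι : Type*} [CommRing R] [IsDomain R]
    [ValuationRing R] (f : ι → R) {s : Finset ι} (hs : s.Nonempty) :
    ∃ i ∈ s, ∀ j ∈ s, f i ∣ f j := by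
  classical
  induction hs using Finset.Nonempty.cons_induction with
  | singleton a => exact ⟨a, by simp, by simp⟩
  | cons a s ha hs ih =>
    obtain ⟨i, hi, hs⟩ := ih
    obtain h | h := ValuationRing.dvd_total (f a) (f i)
    · exact ⟨a, by simp, by simpa using fun j hj ↦ h.trans (hs j hj)⟩
    · exact ⟨i, by simp [hi], by simpa [h] using hs⟩

theorem ValuationRing.exists_aeval_eq_zero_of_isAlgebraic {R N : Type*} [CommRing R] [IsDomain R]
    [ValuationRing R] [Field N] [Algebra R N] [FaithfulSMul R N] {z : N} (hz : IsAlgebraic R z) :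
    ∃ P : R[X], (∃ i, IsUnit (P.coeff i)) ∧ aeval z P = 0 := by
  obtain ⟨p, hp0, hpz⟩ := hz
  obtain ⟨i, hi, hdvd⟩ :=
    ValuationRing.exists_dvd_of_finset p.coeff (Polynomial.support_nonempty.2 hp0)
  have hci : p.coeff i ≠ 0 := mem_support_iff.1 hi
  obtain ⟨P, hP⟩ : C (p.coeff i) ∣ p := by
    refine C_dvd_iff_dvd_coeff _ _ |>.2 fun j ↦ ?_
    by_cases hj : j ∈ p.support
    · exact hdvd j hj
    · simp [notMem_support_iff.1 hj]
  refine ⟨P, ⟨i, ?_⟩, ?_⟩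
  · have := congrArg (fun f ↦ coeff f i) hP
    simp only [coeff_C_mul] at this
    rw [mul_left_cancel₀ hci (this.symm.trans (mul_one _).symm)]
    exact isUnit_one
  · rw [hP, map_mul, aeval_C, mul_eq_zero] at hpz
    exact hpz.resolve_left ((map_ne_zero_iff _ (FaithfulSMul.algebraMap_injective R N)).2 hci)

/-! ### The integral closure of a henselian valuation ring -/

section Henselian

variable {R F : Type*} [CommRing R] [IsDomain R] [HenselianLocalRing R] [ValuationRing R]
  [Field F] [Algebra R F] [IsFractionRing R F]

theorem HenselianLocalRing.isIntegral_or_isIntegral_inv_of_isGalois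
    {N : Type*} [Field N] [Algebra F N] [Algebra R N] [IsScalarTower R F N] [FiniteDimensional F N]
    [IsGalois F N] (z : N) : IsIntegral R z ∨ IsIntegral R z⁻¹ := by
  let B := integralClosure R N
  have : IsFractionRing B N := integralClosure.isFractionRing_of_finite_extension F N
  have : Algebra.IsInvariant R B (B ≃ₐ[R] B) := Algebra.isInvariant_of_isGalois' R F N B
  have : Finite (B ≃ₐ[R] B) := Finite.of_equiv _ (galRestrict R F N B).toEquiv
  have : IsLocalRing B := HenselianLocalRing.isLocalRing_of_isInvariant R B (B ≃ₐ[R] B)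
  have : FaithfulSMul R N := by
    rw [faithfulSMul_iff_algebraMap_injective, IsScalarTower.algebraMap_eq R F N]
    exact (algebraMap F N).injective.comp (IsFractionRing.injective R F)
  have hz : IsAlgebraic R z := (IsFractionRing.isAlgebraic_iff R F N).2 (.of_finite F z)
  obtain ⟨P, hP, hPz⟩ := ValuationRing.exists_aeval_eq_zero_of_isAlgebraic hz
  have := mem_range_or_inv_mem_range_of_aeval_eq_zero (P.map (algebraMap R B)) (z := z)
    (by rwa [aeval_map_algebraMap]) (by
      obtain ⟨i, hi⟩ := hP
      exact ⟨i, by rw [coeff_map]; exact hi.map _⟩)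
  obtain ⟨b, hb⟩ | ⟨b, hb⟩ := this
  · exact .inl (hb ▸ b.2)
  · exact .inr (hb ▸ b.2)

theorem HenselianLocalRing.isIntegral_or_isIntegral_inv_of_isSeparable
    {L : Type*} [Field L] [Algebra F L] [Algebra R L] [IsScalarTower R F L] {z : L}
    (hz : IsSeparable F z) : IsIntegral R z ∨ IsIntegral R z⁻¹ := by
  let N := (minpoly F z).SplittingField
  have : IsGalois F N := IsGalois.of_separable_splitting_field hz
  obtain ⟨φ⟩ : Nonempty (IntermediateField.adjoin F {z} →ₐ[F] N) :=
    IntermediateField.nonempty_algHom_adjoin_of_splits fun s hs ↦ by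
      rw [Set.mem_singleton_iff.1 hs]
      exact ⟨hz.isIntegral, SplittingField.splits _⟩
  let y := IntermediateField.AdjoinSimple.gen F z
  have hφ (u : IntermediateField.adjoin F {z}) (hu : IsIntegral R (φ u)) : IsIntegral R (u : L) :=
    ((isIntegral_algHom_iff (φ.restrictScalars R) φ.injective).1 hu).map
      ((IntermediateField.val _).restrictScalars R)
  obtain h | h := HenselianLocalRing.isIntegral_or_isIntegral_inv_of_isGalois (R := R) (F := F) (φ y)
  · exact .inl (hφ y h)
  · rw [← map_inv₀] at h
    exact .inr (hφ y⁻¹ h)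

theorem HenselianLocalRing.isIntegral_or_isIntegral_inv
    {L : Type*} [Field L] [Algebra F L] [Algebra R L] [IsScalarTower R F L]
    [Algebra.IsAlgebraic F L] (z : L) : IsIntegral R z ∨ IsIntegral R z⁻¹ := by
  -- A power of `z` is separable, and integrality descends from a power.
  obtain ⟨n, y, hy⟩ := IsPurelyInseparable.pow_mem (separableClosure F L) (ringExpChar F) z
  have hq : 0 < ringExpChar F ^ n := pow_pos (expChar_pos F _) n
  suffices h : IsIntegral R (z ^ ringExpChar F ^ n) ∨ IsIntegral R (z ^ ringExpChar F ^ n)⁻¹ by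
    rw [← inv_pow] at h
    exact h.imp (IsIntegral.of_pow hq) (IsIntegral.of_pow hq)
  have hsep : IsSeparable F (z ^ ringExpChar F ^ n) := by
    rw [← hy]
    exact mem_separableClosure_iff.1 y.2
  exact HenselianLocalRing.isIntegral_or_isIntegral_inv_of_isSeparable hsep

end Henselian

/-! ### Multiplicativity and uniqueness of the spectral norm -/

section SpectralNorm

variable {F L : Type*} [NormedField F] [IsUltrametricDist F] [Field L] [Algebra F L]
  [Algebra.IsAlgebraic F L]

omit [IsUltrametricDist F] in
-- The supremum defining the spectral value runs over finitely many terms, roots of norms of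
-- coefficients or zero, so it is attained.
theorem exists_spectralNorm_pow_eq_norm {z : L} (hz : z ≠ 0) :
    ∃ (m : ℕ) (a : F), m ≠ 0 ∧ spectralNorm F L z ^ m = ‖a‖ := by
  have hmem : spectralValue (minpoly F z) ∈ Set.range (spectralValueTerms (minpoly F z)) :=
    (Set.range_nonempty _).csSup_mem (spectralValueTerms_finite_range _)
  obtain ⟨n, hn⟩ := hmem
  change _ = spectralNorm F L z at hn
  have hpos := spectralNorm_zero_lt hz (Algebra.IsAlgebraic.isAlgebraic (R := F) z)
  obtain hlt | hle := lt_or_ge n (minpoly F z).natDegree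
  · refine ⟨(minpoly F z).natDegree - n, (minpoly F z).coeff n, by omega, ?_⟩
    rw [← hn, spectralValueTerms_of_lt_natDegree _ hlt, ← Nat.cast_sub hlt.le, one_div,
      Real.rpow_inv_natCast_pow (norm_nonneg _) (by omega)]
  · rw [spectralValueTerms_of_natDegree_le _ hle] at hn
    exact absurd hn hpos.ne

theorem spectralNorm_smul_pow (a : F) (z : L) (n : ℕ) :
    spectralNorm F L (a • z ^ n) = ‖a‖ * spectralNorm F L z ^ n := by
  rw [spectralNorm_smul a (Algebra.IsAlgebraic.isAlgebraic _), coe_nnnorm]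
  obtain rfl | hn := Nat.eq_zero_or_pos n
  · rw [pow_zero, pow_zero, spectralNorm_one]
  · rw [isPowMul_spectralNorm z hn]

theorem spectralNorm_mul_inv_of_le_one_or
    (h : ∀ z : L, spectralNorm F L z ≤ 1 ∨ spectralNorm F L z⁻¹ ≤ 1) {z : L} (hz : z ≠ 0) :
    spectralNorm F L z * spectralNorm F L z⁻¹ = 1 := by
  have halg (t : L) : IsAlgebraic F t := Algebra.IsAlgebraic.isAlgebraic t
  refine le_antisymm ?_ ?_
  · by_contra! hlt
    obtain ⟨m, a, hm, ha⟩ := exists_spectralNorm_pow_eq_norm (F := F) hz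
    have hzpos := spectralNorm_zero_lt hz (halg z)
    have hapos : 0 < ‖a‖ := ha ▸ pow_pos hzpos m
    have ha0 : a ≠ 0 := norm_pos_iff.1 hapos
    set u : L := a⁻¹ • z ^ m with hu
    have hsu : spectralNorm F L u = 1 := by
      rw [hu, spectralNorm_smul_pow, ha, norm_inv, inv_mul_cancel₀ hapos.ne']
    have hu0 : u ≠ 0 := smul_ne_zero (inv_ne_zero ha0) (pow_ne_zero m hz)
    have huinv : u⁻¹ = a • z⁻¹ ^ m := by
      rw [hu, smul_inv₀, inv_inv, inv_pow]
    have hsui : 1 < spectralNorm F L u⁻¹ := by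
      rw [huinv, spectralNorm_smul_pow, ← ha, ← mul_pow]
      exact one_lt_pow₀ hlt hm
    obtain ⟨k, b, hk, hb⟩ := exists_spectralNorm_pow_eq_norm (F := F) (inv_ne_zero hu0)
    have hb1 : 1 < ‖b‖ := hb ▸ one_lt_pow₀ hsui hk
    have hb0 : ‖b‖ ≠ 0 := by positivity
    -- This element and its inverse both have norm `‖b‖ > 1`: the inverse has norm `‖b‖⁻¹ * ‖b‖ ^
    -- 2`.
    obtain h1 | h1 := h (b • u ^ (2 * k))
    · rw [spectralNorm_smul_pow, hsu, one_pow, mul_one] at h1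
      exact h1.not_gt hb1
    · rw [smul_inv₀, ← inv_pow, spectralNorm_smul_pow, norm_inv, mul_comm 2 k, pow_mul, hb, sq,
        inv_mul_cancel_left₀ hb0] at h1
      exact h1.not_gt hb1
  · rw [← spectralNorm_one (K := F) (L := L), ← mul_inv_cancel₀ hz]
    exact spectralNorm_mul (halg _) (halg _)

/-- The spectral norm as an absolute value, when its unit ball is a valuation ring. -/
noncomputable def spectralAbsoluteValue
    (h : ∀ z : L, spectralNorm F L z ≤ 1 ∨ spectralNorm F L z⁻¹ ≤ 1) : AbsoluteValue L ℝ where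
  toFun := spectralNorm F L
  map_mul' a b := by
    have halg (t : L) : IsAlgebraic F t := Algebra.IsAlgebraic.isAlgebraic t
    obtain rfl | ha := eq_or_ne a 0
    · simp [spectralNorm_zero]
    refine le_antisymm (spectralNorm_mul (halg a) (halg b)) ?_
    calc spectralNorm F L a * spectralNorm F L b
        = spectralNorm F L a * spectralNorm F L (a⁻¹ * (a * b)) := by
          rw [inv_mul_cancel_left₀ ha]
      _ ≤ spectralNorm F L a * (spectralNorm F L a⁻¹ * spectralNorm F L (a * b)) :=
          mul_le_mul_of_nonneg_left (spectralNorm_mul (halg _) (halg _)) (spectralNorm_nonneg _)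
      _ = spectralNorm F L (a * b) := by
          rw [← mul_assoc, spectralNorm_mul_inv_of_le_one_or h ha, one_mul]
  nonneg' := spectralNorm_nonneg
  eq_zero' a := ⟨fun ha ↦ eq_zero_of_map_spectralNorm_eq_zero ha
    (Algebra.IsAlgebraic.isAlgebraic a), fun ha ↦ ha ▸ spectralNorm_zero⟩
  add_le' _ _ := IsNonarchimedean.add_le spectralNorm_nonneg isNonarchimedean_spectralNorm

/-- The spectral norm dominates `w`, both at `z` and at `z⁻¹`; as both products over `z, z⁻¹` equal
`1`, equality holds. -/
theorem AbsoluteValue.eq_spectralNorm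
    (h : ∀ z : L, spectralNorm F L z ≤ 1 ∨ spectralNorm F L z⁻¹ ≤ 1) (w : AbsoluteValue L ℝ)
    (hw : ∀ a : F, w (algebraMap F L a) = ‖a‖) (hna : IsNonarchimedean w) (z : L) :
    w z = spectralNorm F L z := by
  have hle (t : L) : w t ≤ spectralNorm F L t :=
    norm_le_spectralNorm (f :=
      { toFun := w
        map_zero' := map_zero w
        add_le' := w.add_le
        mul_le' a b := (map_mul w a b).le
        neg' := map_neg_eq_map w
        smul' a b := by rw [Algebra.smul_def, map_mul, hw]
        eq_zero_of_map_eq_zero' a ha := w.eq_zero.1 ha })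
      (fun a n _ ↦ map_pow w a n) hna (Algebra.IsAlgebraic.isAlgebraic t)
  obtain rfl | hz := eq_or_ne z 0
  · rw [map_zero, spectralNorm_zero]
  refine le_antisymm (hle z) ?_
  have h1 := spectralNorm_mul_inv_of_le_one_or h hz
  have hwi : w z * w z⁻¹ = 1 := by rw [← map_mul, mul_inv_cancel₀ hz, map_one]
  have hpos : 0 < w z⁻¹ := w.pos (inv_ne_zero hz)
  refine le_of_mul_le_mul_right ?_ hpos
  rw [hwi, ← h1]
  exact mul_le_mul_of_nonneg_left (hle _) (spectralNorm_nonneg _)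

end SpectralNorm

/-! ### Gauss norm estimates from roots -/

section Gauss

variable {K : Type*} [Field K] {S : AbsoluteValue K ℝ}

theorem gaussNorm_X_sub_C_le (hS : IsNonarchimedean S) {c : ℝ} (hc : 0 ≤ c) (b : K) :
    (X - C b).gaussNorm S c ≤ max (S b) c := by
  have h := isNonarchimedean_gaussNorm S hS hc X (C (-b))
  rw [C_neg, ← sub_eq_add_neg, ← C_neg, gaussNorm_C, S.map_neg, max_comm] at h
  have hX : (X : K[X]).gaussNorm S c = c := by
    rw [← monomial_one_one_eq_X, gaussNorm_monomial]
    simp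
  rwa [hX] at h

theorem gaussNorm_mul_pow_le (hS : IsNonarchimedean S) {c d : ℝ} (hc : 0 < c) (hd : 0 ≤ d)
    {g : K[X]} (hg : g.Splits) {x : K}
    (h : ∀ b ∈ g.roots, max (S b) c * d ≤ S (x - b) * c) :
    g.gaussNorm S c * d ^ g.natDegree ≤ S (g.eval x) * c ^ g.natDegree := by
  have key (M : Multiset K) (hM : ∀ b ∈ M, max (S b) c * d ≤ S (x - b) * c) :
      (M.map fun b ↦ X - C b).prod.gaussNorm S c * d ^ M.card ≤
        S ((M.map fun b ↦ X - C b).prod.eval x) * c ^ M.card := by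
    induction M using Multiset.induction with
    | empty =>
      have := gaussNorm_C S c (1 : K)
      rw [C_1] at this
      simp [this]
    | cons b M ih =>
      have ih := ih fun t ht ↦ hM t (Multiset.mem_cons_of_mem ht)
      have hb := (mul_le_mul_of_nonneg_right (gaussNorm_X_sub_C_le hS hc.le b) hd).trans
        (hM b (Multiset.mem_cons_self b M))
      rw [Multiset.map_cons, Multiset.prod_cons, gaussNorm_mul hS hc, eval_mul, map_mul,
        Multiset.card_cons, pow_succ, pow_succ]
      have h1 := gaussNorm_nonneg S (X - C b) hc.le
      have h2 := gaussNorm_nonneg S (M.map fun b ↦ X - C b).prod hc.le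
      have := mul_le_mul hb ih (by positivity) (by positivity)
      simp only [eval_sub, eval_X, eval_C]
      linarith
  have h1 := mul_le_mul_of_nonneg_left (key g.roots h) (S.nonneg g.leadingCoeff)
  rw [← mul_assoc, ← mul_assoc, ← gaussNorm_C S c g.leadingCoeff, ← gaussNorm_mul hS hc,
    gaussNorm_C, ← map_mul, ← eval_C_mul, ← hg.eq_prod_roots, ← hg.natDegree_eq_card_roots] at h1
  exact h1

end Gauss

/-! ### Averaging over conjugates -/

section Conjugates

variable {F E : Type*} [NormedField F] [IsUltrametricDist F] [Field E] [Algebra F E]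

/-- The minimal polynomial over `F` remains irreducible over `E`, the degrees being coprime. -/
theorem minpoly.map_eq_of_coprime {F E L : Type*} [Field F] [Field E] [Field L] [Algebra F E]
    [Algebra F L] [Algebra E L] [IsScalarTower F E L] [FiniteDimensional F E] {a : L}
    (ha : IsIntegral F a)
    (h : (minpoly F a).natDegree.Coprime (Module.finrank F E)) :
    minpoly E a = (minpoly F a).map (algebraMap F E) := by
  have haE : IsIntegral E a := ha.tower_top
  have hdvd : minpoly E a ∣ (minpoly F a).map (algebraMap F E) :=
    minpoly.dvd_map_of_isScalarTower F E a
  have hmonic := (minpoly.monic ha).map (algebraMap F E)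
  refine (eq_of_monic_of_dvd_of_natDegree_le (minpoly.monic haE) hmonic hdvd ?_).symm
  rw [natDegree_map]
  refine Nat.le_of_dvd (minpoly.natDegree_pos haE) ?_
  -- The degree of `a` over `F` divides `[E(a) : F] = [E : F] [E(a) : E]` and is prime to the first
  -- factor.
  refine h.dvd_of_dvd_mul_left ?_
  rw [← IntermediateField.adjoin.finrank haE, Module.finrank_mul_finrank]
  have : FiniteDimensional E (IntermediateField.adjoin E {a}) :=
    IntermediateField.adjoin.finiteDimensional haE
  have : FiniteDimensional F (IntermediateField.adjoin E {a}) := .trans F E _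
  have : IsScalarTower F (IntermediateField.adjoin E {a}) L :=
    .of_algebraMap_eq fun r ↦ by
      rw [IsScalarTower.algebraMap_apply F E L,
        IsScalarTower.algebraMap_apply F E (IntermediateField.adjoin E {a})]
      rfl
  have h1 : minpoly F (IntermediateField.AdjoinSimple.gen E a) = minpoly F a :=
    (minpoly.algebraMap_eq (A := F) (B' := L)
      (algebraMap (IntermediateField.adjoin E {a}) L).injective
      (IntermediateField.AdjoinSimple.gen E a)).symm
  rw [← h1]
  exact minpoly.degree_dvd (IsIntegral.of_finite F _)

theorem exists_mul_spectralNorm_sub_le {L : Type*} [Field L] [Algebra F L] [Algebra E L]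
    [IsScalarTower F E L] [Algebra.IsAlgebraic F L] [Normal E L] {p : ℕ} (hp : p.Prime) [CharP F p]
    (hdeg : Module.finrank F E = p) (x : E) {a : L} (ha : (minpoly F a).natDegree < p) :
    ∃ y : F, spectralNorm F L (algebraMap E L (x - algebraMap F E y)) ≤
        spectralNorm F L (algebraMap E L x) ∧
      max (spectralNorm F L a) (spectralNorm F L (algebraMap E L x)) *
        spectralNorm F L (algebraMap E L (x - algebraMap F E y)) ≤
      spectralNorm F L (algebraMap E L x - a) * spectralNorm F L (algebraMap E L x) := by
  have : FiniteDimensional F E := Module.finite_of_finrank_pos (hdeg ▸ hp.pos)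
  set s := spectralNorm F L with hs
  set z := algebraMap E L x with hz
  have hna : IsNonarchimedean s := isNonarchimedean_spectralNorm
  have hint : IsIntegral F a := (Algebra.IsAlgebraic.isAlgebraic a).isIntegral
  have hs0 (t : L) : 0 ≤ s t := spectralNorm_nonneg t
  have hneg (t : L) : s (-t) = s t := spectralNorm_neg (Algebra.IsAlgebraic.isAlgebraic t)
  obtain hlt | hle := lt_or_ge (s z) (s a)
  · refine ⟨0, by simp [hz], ?_⟩
    have h1 : s a ≤ s (z - a) := by
      have := hna (-(z - a)) z
      rw [hneg, neg_sub, sub_add_cancel] at this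
      exact (le_max_iff.1 this).resolve_right hlt.not_ge
    rw [max_eq_left hlt.le, map_zero, sub_zero]
    exact mul_le_mul_of_nonneg_right h1 (hs0 _)
  · set n := (minpoly F a).natDegree with hn
    have hn0 : 0 < n := minpoly.natDegree_pos hint
    have hcop : n.Coprime (Module.finrank F E) := by
      rw [hdeg]
      exact (Nat.coprime_of_lt_prime hn0.ne' ha hp).symm
    -- `z - b` has the same norm for all conjugates `b` of `a`
    let R := ((minpoly F a).map (algebraMap F L)).roots
    have hR (b : L) (hb : b ∈ R) : s (z - b) = s (z - a) := by
      have hb' : aeval b (minpoly E a) = 0 := by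
        rw [minpoly.map_eq_of_coprime hint hcop, aeval_map_algebraMap]
        exact (mem_aroots'.1 hb).2
      obtain ⟨σ, hσ⟩ := minpoly.exists_algEquiv_of_root'
        (Algebra.IsAlgebraic.isAlgebraic (R := E) a) hb'
      rw [hs, spectralNorm_eq_of_equiv (σ.restrictScalars F) (z - a)]
      simp [hσ, hz]
    have hsplit : ((minpoly F a).map (algebraMap F L)).Splits := by
      rw [IsScalarTower.algebraMap_eq F E L, ← Polynomial.map_map,
        ← minpoly.map_eq_of_coprime hint hcop]
      exact Normal.splits inferInstance a
    have hcard : R.card = n := by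
      rw [← hsplit.natDegree_eq_card_roots, natDegree_map]
    have hsum : (R.map fun b ↦ z - b).sum = n • z + algebraMap F L (minpoly F a).nextCoeff := by
      have h1 := hsplit.nextCoeff_eq_neg_sum_roots_of_monic ((minpoly.monic hint).map _)
      rw [nextCoeff_map (algebraMap F L).injective] at h1
      rw [Multiset.sum_map_sub, Multiset.map_const', Multiset.sum_replicate, hcard, h1,
        Multiset.map_id', sub_eq_add_neg]
    have hsumle (M : Multiset L) (hM : ∀ b ∈ M, s (z - b) = s (z - a)) :
        s (M.map fun b ↦ z - b).sum ≤ s (z - a) := by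
      induction M using Multiset.induction with
      | empty => simpa [hs, spectralNorm_zero] using hs0 (z - a)
      | cons b M ih =>
        rw [Multiset.map_cons, Multiset.sum_cons]
        refine (hna _ _).trans (max_le (hM b (by simp)).le (ih fun t ht ↦ hM t (by simp [ht])))
    -- By Fermat, `n` is a root of unity in `F`.
    have hn1 : ‖(n : F)‖ = 1 := by
      have h1 : (n : F) ^ (p - 1) = 1 := by
        have := Nat.ModEq.pow_totient (x := n) (n := p) (hdeg ▸ hcop)
        rw [Nat.totient_prime hp, ← CharP.natCast_eq_natCast F p] at this
        exact_mod_cast this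
      have h2 := congrArg norm h1
      rw [norm_pow, norm_one] at h2
      exact (pow_eq_one_iff_of_nonneg (norm_nonneg _) (Nat.sub_pos_of_lt hp.one_lt).ne').1 h2
    have hnF : (n : F) ≠ 0 := by
      intro h
      simp [h] at hn1
    -- The witness is the mean of the conjugates: the sum of all `z - b` is `n` times `z` minus this
    -- mean.
    have hy : s (algebraMap E L (x - algebraMap F E (-(minpoly F a).nextCoeff / n))) ≤
        s (z - a) := by
      refine le_trans (le_of_eq ?_) (hsumle R hR)
      rw [hsum, nsmul_eq_mul, ← one_mul (s (algebraMap E L _)), ← hn1, ← coe_nnnorm,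
        ← spectralNorm_smul _ (Algebra.IsAlgebraic.isAlgebraic _)]
      congr 1
      have hnL : (n : L) ≠ 0 := by
        rw [← map_natCast (algebraMap F L)]
        exact (_root_.map_ne_zero _).2 hnF
      rw [Algebra.smul_def, map_natCast, map_sub, ← IsScalarTower.algebraMap_apply, map_div₀,
        map_neg, map_natCast]
      field_simp
      ring
    refine ⟨_, hy.trans ?_, ?_⟩
    · have := hna z (-a)
      rwa [hneg, max_eq_left hle, ← sub_eq_add_neg] at this
    · rw [max_eq_right hle, mul_comm]
      exact mul_le_mul_of_nonneg_right hy (hs0 _)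

end Conjugates

theorem exists_gaussNorm_mul_pow_le {F E : Type*} [NormedField F] [IsUltrametricDist F] [Field E]
    [Algebra F E] {p : ℕ} (hp : p.Prime) [CharP F p] (hdeg : Module.finrank F E = p)
    (h : ∀ z : AlgebraicClosure E, spectralNorm F (AlgebraicClosure E) z ≤ 1 ∨
      spectralNorm F (AlgebraicClosure E) z⁻¹ ≤ 1)
    (w : AbsoluteValue E ℝ) (hw : ∀ a : F, w (algebraMap F E a) = ‖a‖) (hna : IsNonarchimedean w)
    {x : E} (hx : x ≠ 0) {g : F[X]} (hg0 : g ≠ 0) (hg : g.natDegree < p) :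
    ∃ y : F, w (x - algebraMap F E y) ≤ w x ∧ ∀ i,
      ‖g.coeff i‖ * w x ^ i * w (x - algebraMap F E y) ^ (p - 1) ≤
        w (aeval x g) * w x ^ (p - 1) := by
  have : FiniteDimensional F E := Module.finite_of_finrank_pos (hdeg ▸ hp.pos)
  let L := AlgebraicClosure E
  have : Algebra.IsAlgebraic F L := Algebra.IsAlgebraic.trans F E L
  have hsE (t : E) : spectralNorm F L (algebraMap E L t) = w t := by
    rw [← spectralNorm.eq_of_tower, AbsoluteValue.eq_spectralNorm (fun z ↦ ?_) w hw hna]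
    have := h (algebraMap E L z)
    rwa [← map_inv₀, ← spectralNorm.eq_of_tower, ← spectralNorm.eq_of_tower] at this
  let S : AbsoluteValue L ℝ := spectralAbsoluteValue h
  have hSE (t : E) : S (algebraMap E L t) = w t := hsE t
  have hSna : IsNonarchimedean S := isNonarchimedean_spectralNorm
  have hroot (M : Multiset L) (hM : ∀ a ∈ M, (minpoly F a).natDegree < p) :
      ∃ y : F, w (x - algebraMap F E y) ≤ w x ∧
        ∀ a ∈ M, max (S a) (w x) * w (x - algebraMap F E y) ≤
          S (algebraMap E L x - a) * w x := by
    induction M using Multiset.induction with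
    | empty => exact ⟨0, by simp, by simp⟩
    | cons a M ih =>
      obtain ⟨y₁, h₁, h₁'⟩ := ih fun b hb ↦ hM b (Multiset.mem_cons_of_mem hb)
      obtain ⟨y₂, h₂, h₂'⟩ := exists_mul_spectralNorm_sub_le (L := L) hp hdeg x
        (hM a (Multiset.mem_cons_self a M))
      rw [hsE, hsE] at h₂ h₂'
      -- One `y` must serve all roots; the one closer to `x` does.
      obtain hle | hle := le_total (w (x - algebraMap F E y₁)) (w (x - algebraMap F E y₂))
      · refine ⟨y₁, h₁, Multiset.forall_mem_cons.2 ⟨le_trans ?_ h₂', h₁'⟩⟩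
        exact mul_le_mul_of_nonneg_left hle (le_max_of_le_right (w.nonneg _))
      · refine ⟨y₂, h₂, Multiset.forall_mem_cons.2 ⟨h₂', fun b hb ↦ le_trans ?_ (h₁' b hb)⟩⟩
        exact mul_le_mul_of_nonneg_left hle (le_max_of_le_right (w.nonneg _))
  set G : L[X] := g.map (algebraMap F L) with hG
  obtain ⟨y, hy, hyM⟩ := hroot G.roots fun a ha ↦ by
    have ha' : aeval a g = 0 := (mem_aroots'.1 ha).2
    exact (natDegree_le_of_dvd (minpoly.dvd F a ha') hg0).trans_lt hg
  refine ⟨y, hy, fun i ↦ ?_⟩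
  have hx0 : 0 < w x := w.pos hx
  have hd := w.nonneg (x - algebraMap F E y)
  have h1 := gaussNorm_mul_pow_le hSna hx0 hd (IsAlgClosed.splits G) hyM
  have h2 : ‖g.coeff i‖ * w x ^ i ≤ G.gaussNorm S (w x) := by
    convert G.le_gaussNorm S hx0.le i using 2
    rw [hG, coeff_map]
    exact (spectralNorm_extends _).symm
  have h3 : S (G.eval (algebraMap E L x)) = w (aeval x g) := by
    rw [hG, eval_map_algebraMap, aeval_algebraMap_apply, hSE]
  rw [h3, hG, natDegree_map] at h1
  -- The exponent is raised from `deg g` to `p - 1` using `w (x - y) ≤ w x`.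
  obtain ⟨k, hk⟩ : ∃ k, p - 1 = g.natDegree + k := ⟨p - 1 - g.natDegree, by omega⟩
  rw [hk, pow_add, pow_add, ← mul_assoc, ← mul_assoc]
  refine mul_le_mul ((mul_le_mul_of_nonneg_right h2 (by positivity)).trans h1)
    (pow_le_pow_left₀ hd hy k) (by positivity) (by positivity)

/-! ### From real valuations to absolute values -/

namespace RealValuation

/-- The decreasing exponential `exp (-a)` on `ℝ ∪ {∞}`. -/
noncomputable def expNeg : WithTop ℝ → ℝ :=
  WithTop.recTopCoe 0 fun r ↦ Real.exp (-r)

@[simp] theorem expNeg_top : expNeg ⊤ = 0 := rfl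

@[simp] theorem expNeg_coe (r : ℝ) : expNeg r = Real.exp (-r) := rfl

theorem expNeg_nonneg (a : WithTop ℝ) : 0 ≤ expNeg a := by
  induction a with
  | top => simp
  | coe r => exact (Real.exp_pos _).le

theorem expNeg_add (a b : WithTop ℝ) : expNeg (a + b) = expNeg a * expNeg b := by
  induction a with
  | top => simp
  | coe r =>
    induction b with
    | top => simp
    | coe t => rw [← WithTop.coe_add, expNeg_coe, neg_add, Real.exp_add, expNeg_coe, expNeg_coe]

theorem expNeg_le_expNeg {a b : WithTop ℝ} : expNeg a ≤ expNeg b ↔ b ≤ a := by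
  induction a with
  | top => simp [expNeg_nonneg]
  | coe r =>
    induction b with
    | top => simp [Real.exp_pos]
    | coe t => simp

variable {K : Type*} [Field K]

theorem expNeg_add_le_max (v : RealValuation K) (a b : K) :
    expNeg (v (a + b)) ≤ max (expNeg (v a)) (expNeg (v b)) := by
  obtain h | h := min_le_iff.1 (v.map_add a b)
  · exact le_max_of_le_left (expNeg_le_expNeg.2 h)
  · exact le_max_of_le_right (expNeg_le_expNeg.2 h)

/-- The absolute value `exp (-v a)` of a real valuation `v`. -/
noncomputable def toAbsoluteValue (v : RealValuation K) : AbsoluteValue K ℝ where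
  toFun a := expNeg (v a)
  map_mul' a b := by rw [v.map_mul, expNeg_add]
  nonneg' a := expNeg_nonneg _
  eq_zero' a := by
    rw [← v.top_iff, ← expNeg_top, le_antisymm_iff, expNeg_le_expNeg, expNeg_le_expNeg,
      ← le_antisymm_iff, eq_comm]
  add_le' a b := (v.expNeg_add_le_max a b).trans
    (max_le_add_of_nonneg (expNeg_nonneg _) (expNeg_nonneg _))

theorem toAbsoluteValue_apply (v : RealValuation K) (a : K) :
    v.toAbsoluteValue a = expNeg (v a) := rfl

theorem isNonarchimedean_toAbsoluteValue (v : RealValuation K) :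
    IsNonarchimedean v.toAbsoluteValue := v.expNeg_add_le_max

theorem mem_integer_iff (v : RealValuation K) (a : K) :
    a ∈ (AddValuation.toValuation v).integer ↔ v.toAbsoluteValue a ≤ 1 := by
  have h1 : (1 : ℝ) = expNeg 0 := by
    have := expNeg_coe 0
    simp_all
  rw [toAbsoluteValue_apply, h1, expNeg_le_expNeg]
  exact Iff.rfl

theorem spectralNorm_le_one_or (v : RealValuation K) (hv : v.IsHenselian) {L : Type*} [Field L]
    [Algebra K L] [Algebra.IsAlgebraic K L] (z : L) :
    letI := v.toAbsoluteValue.toNormedField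
    spectralNorm K L z ≤ 1 ∨ spectralNorm K L z⁻¹ ≤ 1 := by
  let := v.toAbsoluteValue.toNormedField
  let R := (AddValuation.toValuation v).integer
  have : HenselianLocalRing R := hv
  have key (t : L) (ht : IsIntegral R t) : spectralNorm K L t ≤ 1 := by
    have halg : IsIntegral K t := ht.tower_top
    refine (spectralValue_le_one_iff (minpoly.monic halg)).2 fun n ↦ ?_
    -- The valuation ring is integrally closed, so the minimal polynomial has coefficients of norm
    -- at most `1`.
    rw [minpoly.isIntegrallyClosed_eq_field_fractions' K ht, coeff_map]
    exact (v.mem_integer_iff _).1 ((minpoly R t).coeff n).2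
  exact (HenselianLocalRing.isIntegral_or_isIntegral_inv (R := R) (F := K) z).imp (key _) (key _)

end RealValuation

/-! ### The power basis and the two inequalities -/

theorem Module.Basis.aeval_eq_sum_of_natDegree_lt {F E : Type*} [Field F] [Field E] [Algebra F E]
    {n : ℕ} (T : Module.Basis (Fin n) F E) {x : E} (hT : ∀ i : Fin n, T i = x ^ (i : ℕ)) {g : F[X]}
    (hg : g.natDegree < n) : aeval x g = ∑ i : Fin n, g.coeff i • T i := by
  simp only [aeval_eq_sum_range' hg, hT, Finset.sum_range]

theorem Module.Basis.exists_polynomial_of_pow {F E : Type*} [Field F] [Field E] [Algebra F E]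
    {n : ℕ} (T : Module.Basis (Fin n) F E) {x : E} (hT : ∀ i : Fin n, T i = x ^ (i : ℕ)) (u : E) :
    ∃ g : F[X], aeval x g = u ∧ (∀ i : Fin n, g.coeff i = T.repr u i) ∧ g.degree < n := by
  refine ⟨∑ i : Fin n, C (T.repr u i) * X ^ (i : ℕ), ?_, fun i ↦ ?_, ?_⟩
  · conv_rhs => rw [← T.sum_repr u]
    simp only [map_sum, map_mul, aeval_C, map_pow, aeval_X, hT, Algebra.smul_def]
  · simp only [finsetSum_coeff, coeff_C_mul_X_pow]
    rw [Finset.sum_eq_single i]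
    · simp
    · intro j _ hj
      rw [if_neg]
      exact fun h ↦ hj (Fin.ext h.symm)
    · simp
  · refine (degree_sum_le _ _).trans_lt ((Finset.sup_lt_iff (WithBot.bot_lt_coe n)).2 fun i _ ↦ ?_)
    exact (degree_C_mul_X_pow_le _ _).trans_lt (WithBot.coe_lt_coe.2 i.2)

namespace RealValuation

theorem toEReal_mono {a b : WithTop ℝ} (h : a ≤ b) : toEReal a ≤ toEReal b :=
  WithBot.coe_le_coe.2 h

theorem toEReal_coe (r : ℝ) : toEReal (r : WithTop ℝ) = (r : EReal) := rfl

section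

variable {F E : Type*} [Field F] [Field E] [Algebra F E] {n : ℕ} {w : RealValuation E} {x : E}
  {T : Module.Basis (Fin n) F E}

/-- Powers of `x - y` witness that the discrepancy of the basis of powers of `x` is large. -/
theorem mul_ndist_le_discrepancy (hT : ∀ i : Fin n, T i = x ^ (i : ℕ)) (hn : 1 < n)
    (hx : x ∉ Set.range (algebraMap F E)) :
    ((n - 1 : ℕ) : EReal) * ndist w x (Set.range (algebraMap F E)) ≤ discrepancy w T := by
  have hpos : (0 : EReal) < ((n - 1 : ℕ) : EReal) := by
    exact_mod_cast Nat.sub_pos_of_lt hn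
  have htop : ((n - 1 : ℕ) : EReal) ≠ ⊤ := EReal.natCast_ne_top _
  rw [mul_comm, ← EReal.le_div_iff_mul_le hpos htop]
  refine iSup₂_le ?_
  rintro _ ⟨y, rfl⟩
  rw [EReal.le_div_iff_mul_le hpos htop]
  have hxy : x - algebraMap F E y ≠ 0 := fun h ↦ hx ⟨y, (sub_eq_zero.1 h).symm⟩
  have hx0 : x ≠ 0 := fun h ↦ hx ⟨0, by rw [map_zero, h]⟩
  refine le_trans ?_ (le_iSup₂ (f := fun u _ ↦ discrepancyAt w T u) _ (pow_ne_zero (n - 1) hxy))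
  -- The top coordinate is the leading coefficient of `(X - y)^(n-1)`, so the minimum is at most `(n
  -- - 1) v(x)`.
  have hrepr : T.repr ((x - algebraMap F E y) ^ (n - 1)) ⟨n - 1, by omega⟩ = 1 := by
    have hmonic : ((X - C y) ^ (n - 1)).Monic := (monic_X_sub_C y).pow _
    have hdeg : ((X - C y) ^ (n - 1)).natDegree = n - 1 := by
      rw [natDegree_pow, natDegree_X_sub_C, mul_one]
    have h1 := T.aeval_eq_sum_of_natDegree_lt hT (g := (X - C y) ^ (n - 1)) (by omega)
    rw [map_pow, map_sub, aeval_X, aeval_C] at h1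
    rw [h1, T.repr_sum_self]
    simpa only [Monic, leadingCoeff, hdeg] using hmonic
  have hinf : (Finset.univ.inf fun i ↦
      w (T.repr ((x - algebraMap F E y) ^ (n - 1)) i • T i)) ≤ (n - 1) • w x := by
    refine (Finset.inf_le (Finset.mem_univ (⟨n - 1, by omega⟩ : Fin n))).trans ?_
    rw [hrepr, one_smul, hT, AddValuation.map_pow]
  refine le_trans ?_ (EReal.sub_le_sub le_rfl (toEReal_mono hinf))
  obtain ⟨r, hr⟩ := WithTop.ne_top_iff_exists.1 (w.ne_top_iff.2 hxy)
  obtain ⟨t, ht⟩ := WithTop.ne_top_iff_exists.1 (w.ne_top_iff.2 hx0)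
  rw [AddValuation.map_pow, ← hr, ← ht, ← WithTop.coe_nsmul, ← WithTop.coe_nsmul]
  simp only [toEReal_coe, ← EReal.coe_coe_eq_natCast, ← EReal.coe_sub, ← EReal.coe_mul,
    EReal.coe_le_coe_iff, nsmul_eq_mul]
  linarith

theorem discrepancyAt_le {u : E} (hu : u ≠ 0) (hn : 1 < n)
    (hx : x ∉ Set.range (algebraMap F E)) (y : F)
    (h : ∀ i : Fin n, w u + (n - 1) • w x ≤
      w (T.repr u i • T i) + (n - 1) • w (x - algebraMap F E y)) :
    discrepancyAt w T u ≤
      ((n - 1 : ℕ) : EReal) * ndist w x (Set.range (algebraMap F E)) := by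
  have hxy : x - algebraMap F E y ≠ 0 := fun h ↦ hx ⟨y, (sub_eq_zero.1 h).symm⟩
  have hx0 : x ≠ 0 := fun h ↦ hx ⟨0, by rw [map_zero, h]⟩
  have hle : toEReal (w (x - algebraMap F E y)) - toEReal (w x) ≤
      ndist w x (Set.range (algebraMap F E)) :=
    le_iSup₂ (f := fun z _ ↦ toEReal (w (x - z)) - toEReal (w x)) _ ⟨y, rfl⟩
  refine le_trans ?_ (mul_le_mul_of_nonneg_left hle
    (show (0 : EReal) ≤ ((n - 1 : ℕ) : EReal) by exact_mod_cast Nat.zero_le _))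
  have : Nonempty (Fin n) := ⟨⟨0, by omega⟩⟩
  obtain ⟨i, -, hi⟩ := Finset.exists_mem_eq_inf Finset.univ Finset.univ_nonempty
    fun i ↦ w (T.repr u i • T i)
  -- Finiteness of the minimum reduces the extended inequality to one between reals.
  have hfin : w (T.repr u i • T i) ≠ ⊤ := by
    obtain ⟨j, hj⟩ : ∃ j, T.repr u j ≠ 0 := by
      by_contra! hcon
      exact hu (T.repr.map_eq_zero_iff.1 (Finsupp.ext hcon))
    rw [← hi]
    refine ne_top_of_le_ne_top ?_ (Finset.inf_le (Finset.mem_univ j))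
    exact w.ne_top_iff.2 (smul_ne_zero hj (T.ne_zero j))
  have hi' := h i
  rw [discrepancyAt, hi]
  obtain ⟨r, hr⟩ := WithTop.ne_top_iff_exists.1 (w.ne_top_iff.2 hxy)
  obtain ⟨t, ht⟩ := WithTop.ne_top_iff_exists.1 (w.ne_top_iff.2 hx0)
  obtain ⟨q, hq⟩ := WithTop.ne_top_iff_exists.1 (w.ne_top_iff.2 hu)
  obtain ⟨m, hm⟩ := WithTop.ne_top_iff_exists.1 hfin
  rw [← hr, ← ht, ← hq, ← hm, ← WithTop.coe_nsmul, ← WithTop.coe_nsmul, ← WithTop.coe_add,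
    ← WithTop.coe_add, WithTop.coe_le_coe] at hi'
  rw [← hr, ← ht, ← hq, ← hm]
  simp only [toEReal_coe, ← EReal.coe_coe_eq_natCast, ← EReal.coe_sub, ← EReal.coe_mul,
    EReal.coe_le_coe_iff]
  simp only [nsmul_eq_mul] at hi'
  linarith

end

theorem exists_forall_add_nsmul_le {F E : Type*} [Field F] [Field E] [Algebra F E] {p : ℕ}
    (hp : p.Prime) [CharP F p] {v : RealValuation F} (hv : v.IsHenselian) {w : RealValuation E}
    (hw : ∀ a : F, w (algebraMap F E a) = v a) (hdeg : Module.finrank F E = p) {x : E}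
    (hx : x ≠ 0) {g : F[X]} (hg0 : g ≠ 0) (hg : g.natDegree < p) :
    ∃ y : F, ∀ i : ℕ, w (aeval x g) + (p - 1) • w x ≤
      w (g.coeff i • x ^ i) + (p - 1) • w (x - algebraMap F E y) := by
  let := v.toAbsoluteValue.toNormedField
  have : IsUltrametricDist F :=
    IsUltrametricDist.isUltrametricDist_of_isNonarchimedean_norm v.isNonarchimedean_toAbsoluteValue
  have : FiniteDimensional F E := Module.finite_of_finrank_pos (hdeg ▸ hp.pos)
  have : Algebra.IsAlgebraic F (AlgebraicClosure E) := Algebra.IsAlgebraic.trans F E _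
  have hpow (a : E) (n : ℕ) : w.toAbsoluteValue a ^ n = expNeg (n • w a) := by
    rw [← map_pow, toAbsoluteValue_apply, AddValuation.map_pow]
  obtain ⟨y, -, hy⟩ := exists_gaussNorm_mul_pow_le hp hdeg
    (fun z ↦ v.spectralNorm_le_one_or hv z) w.toAbsoluteValue
    (fun a ↦ congrArg expNeg (hw a)) w.isNonarchimedean_toAbsoluteValue hx hg0 hg
  refine ⟨y, fun i ↦ expNeg_le_expNeg.1 ?_⟩
  have h := hy i
  have hn : ‖g.coeff i‖ = expNeg (w (algebraMap F E (g.coeff i))) := congrArg expNeg (hw _).symm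
  rwa [hpow, hpow, hpow, hn, toAbsoluteValue_apply, ← expNeg_add, ← expNeg_add, ← expNeg_add,
    ← AddValuation.map_pow w x i, ← AddValuation.map_mul, ← Algebra.smul_def] at h

end RealValuation

theorem proposition5p1 {F E : Type*} [Field F] [Field E] [Algebra F E]
    (p : ℕ) (hp : p.Prime) (hchar : CharP F p)
    (v : RealValuation F) (hv : v.IsHenselian)
    (w : RealValuation E) (hw : ∀ a : F, w (algebraMap F E a) = v a)
    (hdeg : Module.finrank F E = p)
    (x : E) (hx : IntermediateField.adjoin F {x} = ⊤) :
    ∃ T : Module.Basis (Fin p) F E, (∀ i : Fin p, T i = x ^ (i : ℕ)) ∧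
      RealValuation.discrepancy w T =
        ((p - 1 : ℕ) : EReal) * RealValuation.ndist w x (Set.range (algebraMap F E)) := by
  have : FiniteDimensional F E := Module.finite_of_finrank_pos (hdeg ▸ hp.pos)
  have : Nonempty (Fin p) := ⟨⟨0, hp.pos⟩⟩
  have hnat : (minpoly F x).natDegree = p :=
    ((Field.primitive_element_iff_minpoly_natDegree_eq F x).1 hx).trans hdeg
  have hli : LinearIndependent F fun i : Fin p ↦ x ^ (i : ℕ) := by
    have := linearIndependent_pow (K := F) x
    rwa [hnat] at this
  let T := basisOfLinearIndependentOfCardEqFinrank hli (by rw [Fintype.card_fin, hdeg])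
  have hT (i : Fin p) : T i = x ^ (i : ℕ) := by
    simp [T]
  have hxF : x ∉ Set.range (algebraMap F E) := by
    rintro ⟨y, rfl⟩
    rw [minpoly.eq_X_sub_C, natDegree_X_sub_C] at hnat
    exact hp.one_lt.ne hnat
  have hx0 : x ≠ 0 := fun h ↦ hxF ⟨0, by rw [map_zero, h]⟩
  refine ⟨T, hT, le_antisymm (iSup₂_le fun u hu ↦ ?_)
    (RealValuation.mul_ndist_le_discrepancy hT hp.one_lt hxF)⟩
  obtain ⟨g, hgu, hgc, hgdeg⟩ := T.exists_polynomial_of_pow hT u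
  have hg0 : g ≠ 0 := by
    rintro rfl
    exact hu (by rw [← hgu, map_zero])
  obtain ⟨y, hy⟩ := RealValuation.exists_forall_add_nsmul_le hp hv hw hdeg hx0 hg0
    ((natDegree_lt_iff_degree_lt hg0).2 hgdeg)
  refine RealValuation.discrepancyAt_le hu hp.one_lt hxF y fun i ↦ ?_
  rw [← hgc, hT, ← hgu]
  exact hy i
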